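/- Let $d\ge 2$ and work on $\mathbb C^d$, with $\mathcal L(\mathbb C^d)$ its algebra of operators. A meter is a finite family of positive semidefinite operators summing to $\mathbb 1$; a joint meter of $\mathsf M,\mathsf N$ is a meter $\mathsf G$ on pairs of outcomes with $\sum_y\mathsf G(x,y)=\mathsf M(x)$ and $\sum_x\mathsf G(x,y)=\mathsf N(y)$. A sharp meter is $\mathsf Q(x)=|\varphi_x\rangle\langle\varphi_x|$ for an orthonormal basis $(\varphi_x)_{x=0}^{d-1}$; its noisy versions are $\mathsf Q_s(x)=s\,\mathsf Q(x)+(1-s)\frac1d\mathbb 1$, $s\in[0,1]$. Sharp meters $\mathsf Q,\mathsf P$ are mutually unbiased if $\operatorname{tr}(\mathsf Q(x)\mathsf P(y))=\frac1d$ for all $x,y$. A channel is a completely positive trace-preserving linear map; an instrument is a family $\mathcal J(x,\cdot)$ of completely positive linear maps on $\mathcal L(\mathbb C^d)$, $x=0,\dots,d-1$, whose sum is a channel; $\dagger$ denotes the adjoint with respect to $\operatorname{tr}(AB)$. Let $I_r(\varrho)=r\varrho+(1-r)\operatorname{tr}(\varrho)\frac1d\mathbb 1$. Define the following subsets of $[0,1]\times[0,1]$: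 * $\mathrm{CR}(\mathsf Q,\mathsf P)$: all $(s,t)$ such that $\mathsf Q_s$ and $\mathsf P_t$ have a joint meter; * $\mathrm{CR}(I,I)$: all $(s,t)$ such that some channel $\Gamma:\mathcal L(\mathbb C^d)\to\mathcal L(\mathbb C^d\otimes\mathbb C^d)$ has reduced channels $I_s$ (on the first factor) and $I_t$ (on the second factor) (approximate cloning); * $\mathrm{CR}(\mathsf Q,I)$: all $(s,t)$ such that some instrument $\mathcal J$ satisfies $\mathcal J^\dagger(x,\mathbb 1)=\mathsf Q_s(x)$ for all $x$ and $\sum_x\mathcal J(x,\cdot)=I_t$; * $\mathrm{SR}(\mathsf Q)$: all $(s,t)$ for which there is one instrument $\mathcal J$ such that, for every sharp meter $\mathsf P'$ mutually unbiased with $\mathsf Q$, the sequential measurement $(x,y)\mapsto\mathcal J^\dagger(x,\mathsf P'(y))$ is a joint meter of $\mathsf Q_s$ and $\mathsf P'_t$ (only $\mathsf Q$ is fixed, and $\mathsf P'$ is chosen after the first measurement). For $s\in[0,1]$ let $\tau_d(s)=1-\frac1d\big(\sqrt{s(d-1)+1}-\sqrt{1-s}\big)^2$ and let $\mathcal J_L^{(s)}(x,\varrho)=\mathsf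 Q_s(x)^{1/2}\varrho\,\mathsf Q_s(x)^{1/2}$ be the Lüders instrument of $\mathsf Q_s$. **Theorem.** Let $\mathsf Q$ and $\mathsf P$ be mutually unbiased sharp meters on $\mathbb C^d$, $d\ge2$. Then: 1. $\mathrm{SR}(\mathsf Q)=\mathrm{CR}(\mathsf Q,\mathsf P)$, i.e. postponing the choice of $\mathsf P$ yields the same trade-off as measuring an optimal joint meter of the specific pair. 2. $\mathrm{CR}(\mathsf Q,\mathsf P)=\{(s,t)\in[0,1]^2: t\le\tau_d(s)\}$. 3. For every $s\in[0,1]$, $\tau_d(s)\in[0,1]$, $\mathcal J_L^{(s)}$ is an instrument with $\mathcal J_L^{(s)\dagger}(x,\mathbb 1)=\mathsf Q_s(x)$, and for every sharp meter $\mathsf P'$ mutually unbiased with $\mathsf Q$ the sequential measurement $\mathcal J_L^{(s)\dagger}(x,\mathsf P'(y))$ is a joint meter of $\mathsf Q_s$ and $\mathsf P'_{\tau_d(s)}$. 4. For every $(s,t)\in\mathrm{CR}(\mathsf Q,\mathsf P)$ there is $r\in[0,1]$ such that, for every sharp meter $\mathsf P'$ mutually unbiased with $\mathsf Q$, $\mathcal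 J_L^{(s)\dagger}(x,\mathsf P'_r(y))$ is a joint meter of $\mathsf Q_s$ and $\mathsf P'_t$. 5. $\mathrm{CR}(I,I)\subsetneq\mathrm{SR}(\mathsf Q)$ and $\mathrm{CR}(\mathsf Q,I)\subsetneq\mathrm{SR}(\mathsf Q)$, i.e. knowing $\mathsf Q$ in advance is a strict advantage over cloning, and unbiasedness of $\mathsf P$ is a strict advantage over an arbitrary second meter. -/

import Mathlib

/-!
Finite-dimensional quantum devices.  The algebra of operators on `ℂ^d` is
`Matrix (Fin d) (Fin d) ℂ`; the one on `ℂ^d ⊗ ℂ^d` is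
`Matrix (Fin d × Fin d) (Fin d × Fin d) ℂ`.
-/

namespace QDevices

noncomputable section

open scoped ComplexOrder in
/-- A meter (POVM) with outcomes in the finite set `X`. -/
structure IsMeter {X n : Type*} [Fintype X] [Fintype n] [DecidableEq n]
    (M : X → Matrix n n ℂ) : Prop where
  posSemidef : ∀ x, (M x).PosSemidef
  sum_eq_one : ∑ x, M x = 1

/-- A sharp meter on `ℂ^d`: `Q x = |φ x⟩⟨φ x|` for some orthonormal basis `φ`. -/
def IsSharpMeter {d : ℕ} (Q : Fin d → Matrix (Fin d) (Fin d) ℂ) : Prop :=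
  ∃ φ : OrthonormalBasis (Fin d) ℂ (EuclideanSpace ℂ (Fin d)),
    ∀ x, Q x = Matrix.vecMulVec (φ x).ofLp (star (φ x).ofLp)

/-- Two sharp meters on `ℂ^d` are mutually unbiased if `tr (Q x P y) = 1 / d` for all `x`, `y`. -/
def MutuallyUnbiased {d : ℕ} (Q P : Fin d → Matrix (Fin d) (Fin d) ℂ) : Prop :=
  ∀ x y, (Q x * P y).trace = 1 / (d : ℂ)

/-- The noisy version `M_s x = s M x + (1 - s) 1 / d` of a meter on `ℂ^d`. -/
def noisy {d : ℕ} (M : Fin d → Matrix (Fin d) (Fin d) ℂ) (s : ℝ) :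
    Fin d → Matrix (Fin d) (Fin d) ℂ :=
  fun x => (s : ℂ) • M x + ((1 - s : ℝ) / d : ℂ) • (1 : Matrix (Fin d) (Fin d) ℂ)

/-- `G` is a joint meter of `M` and `N`. -/
structure IsJointMeter {X Y n : Type*} [Fintype X] [Fintype Y] [Fintype n] [DecidableEq n]
    (G : X × Y → Matrix n n ℂ) (M : X → Matrix n n ℂ) (N : Y → Matrix n n ℂ) : Prop where
  isMeter : IsMeter G
  fst_marginal : ∀ x, ∑ y, G (x, y) = M x
  snd_marginal : ∀ y, ∑ x, G (x, y) = N y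

open scoped MatrixOrder Matrix.Norms.L2Operator in
/-- Complete positivity, in the sense of Mathlib's `CompletelyPositiveMap` (matrix algebras carry
the Loewner order and their usual C⋆-algebra structure). -/
def IsCP {m n : Type*} [Fintype m] [DecidableEq m] [Fintype n] [DecidableEq n]
    (Φ : Matrix m m ℂ →ₗ[ℂ] Matrix n n ℂ) : Prop :=
  ∃ Ψ : CompletelyPositiveMap (Matrix m m ℂ) (Matrix n n ℂ), Ψ.toLinearMap = Φ

/-- A channel (Schrödinger picture): a completely positive trace-preserving linear map. -/
structure IsChannel {m n : Type*} [Fintype m] [DecidableEq m] [Fintype n] [DecidableEq n]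
    (Φ : Matrix m m ℂ →ₗ[ℂ] Matrix n n ℂ) : Prop where
  isCP : IsCP Φ
  trace_eq : ∀ A, (Φ A).trace = A.trace

/-- An instrument with outcomes in `X`: each `J x` is linear and completely positive, and
`∑ x, J x` is a channel. -/
structure IsInstrument {X m n : Type*} [Fintype X] [Fintype m] [DecidableEq m] [Fintype n]
    [DecidableEq n] (J : X → (Matrix m m ℂ →ₗ[ℂ] Matrix n n ℂ)) : Prop where
  isCP : ∀ x, IsCP (J x)
  isChannel_sum : IsChannel (∑ x, J x)

/-- The adjoint (Heisenberg picture) `Φ†` of a linear map, given by its matrix entries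
`(Φ† A) i j = tr (Φ (E j i) A)`; see `trace_mul_adj` for its defining property. -/
def adj {m n : Type*} [Fintype n] [DecidableEq m]
    (Φ : Matrix m m ℂ →ₗ[ℂ] Matrix n n ℂ) (A : Matrix n n ℂ) : Matrix m m ℂ :=
  Matrix.of fun i j => (Φ (Matrix.single j i 1) * A).trace

theorem trace_mul_adj {m n : Type*} [Fintype m] [Fintype n] [DecidableEq m]
    (Φ : Matrix m m ℂ →ₗ[ℂ] Matrix n n ℂ) (ρ : Matrix m m ℂ) (A : Matrix n n ℂ) :
    (ρ * adj Φ A).trace = (Φ ρ * A).trace := by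
  conv_rhs => rw [Matrix.matrix_eq_sum_single ρ]
  simp only [map_sum, Finset.sum_mul, Matrix.trace_sum]
  rw [Matrix.trace]
  simp only [Matrix.diag_apply, Matrix.mul_apply, adj, Matrix.of_apply]
  refine Finset.sum_congr rfl fun i _ => Finset.sum_congr rfl fun j _ => ?_
  have h : Matrix.single i j (ρ i j) = ρ i j • Matrix.single i j (1 : ℂ) := by simp
  rw [h, map_smul, Matrix.smul_mul, Matrix.trace_smul, smul_eq_mul]

/-- The meter `(x, y) ↦ J†(x, N y)` obtained by first applying the instrument `J` and then
measuring the meter `N`. -/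
def sequentialMeter {X Y m n : Type*} [Fintype n] [DecidableEq m]
    (J : X → (Matrix m m ℂ →ₗ[ℂ] Matrix n n ℂ)) (N : Y → Matrix n n ℂ) :
    X × Y → Matrix m m ℂ :=
  fun p => adj (J p.1) (N p.2)

open scoped MatrixOrder in
/-- The Lüders instrument `ρ ↦ M(x)^{1/2} ρ M(x)^{1/2}` of a meter `M`. -/
def luders {X n : Type*} [Fintype n] [DecidableEq n] (M : X → Matrix n n ℂ) :
    X → (Matrix n n ℂ →ₗ[ℂ] Matrix n n ℂ) :=
  fun x => LinearMap.mulLeft ℂ (CFC.sqrt (M x)) ∘ₗ LinearMap.mulRight ℂ (CFC.sqrt (M x))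

/-- The depolarizing channel `I_r ρ = r ρ + (1 - r) tr(ρ) 1 / d`. -/
def depol (d : ℕ) (r : ℝ) (ρ : Matrix (Fin d) (Fin d) ℂ) : Matrix (Fin d) (Fin d) ℂ :=
  (r : ℂ) • ρ + (((1 - r : ℝ) / d : ℂ) * ρ.trace) • (1 : Matrix (Fin d) (Fin d) ℂ)

/-- Partial trace over the second tensor factor. -/
def ptrSnd {m n : Type*} [Fintype n] (A : Matrix (m × n) (m × n) ℂ) : Matrix m m ℂ :=
  Matrix.of fun i j => ∑ k, A (i, k) (j, k)

/-- Partial trace over the first tensor factor. -/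
def ptrFst {m n : Type*} [Fintype m] (A : Matrix (m × n) (m × n) ℂ) : Matrix n n ℂ :=
  Matrix.of fun i j => ∑ k, A (k, i) (k, j)

/-- The square `[0,1] × [0,1]` of noise parameters. -/
def unitSquare : Set (ℝ × ℝ) := Set.Icc 0 1 ×ˢ Set.Icc 0 1

/-- `CR(Q,P)`: the noise parameters `(s,t)` such that `Q_s` and `P_t` have a joint meter. -/
def regionMeters {d : ℕ} (Q P : Fin d → Matrix (Fin d) (Fin d) ℂ) : Set (ℝ × ℝ) :=
  {p ∈ unitSquare | ∃ G : Fin d × Fin d → Matrix (Fin d) (Fin d) ℂ,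
    IsJointMeter G (noisy Q p.1) (noisy P p.2)}

/-- `CR(I,I)`: the noise parameters `(s,t)` such that the depolarizing channels `I_s` and `I_t`
have a joint channel (an approximate cloner). -/
def regionCloning (d : ℕ) : Set (ℝ × ℝ) :=
  {p ∈ unitSquare | ∃ Γ : Matrix (Fin d) (Fin d) ℂ →ₗ[ℂ]
      Matrix (Fin d × Fin d) (Fin d × Fin d) ℂ,
    IsChannel Γ ∧ (∀ ρ, ptrSnd (Γ ρ) = depol d p.1 ρ) ∧ (∀ ρ, ptrFst (Γ ρ) = depol d p.2 ρ)}

/-- `CR(Q,I)`: the noise parameters `(s,t)` such that the meter `Q_s` and the depolarizing channel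
`I_t` have a joint instrument. -/
def regionMeterChannel {d : ℕ} (Q : Fin d → Matrix (Fin d) (Fin d) ℂ) : Set (ℝ × ℝ) :=
  {p ∈ unitSquare | ∃ J : Fin d → (Matrix (Fin d) (Fin d) ℂ →ₗ[ℂ] Matrix (Fin d) (Fin d) ℂ),
    IsInstrument J ∧ (∀ x, adj (J x) 1 = noisy Q p.1 x) ∧
      (∀ ρ, ∑ x, J x ρ = depol d p.2 ρ)}

/-- The noise parameters `(s,t)` achievable by a sequential scheme in which only `Q` is fixed:
one instrument, chosen before `P`, followed by a measurement of `P`, yields a joint meter of `Q_s`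
and `P_t` for every sharp meter `P` that is mutually unbiased with respect to `Q`. -/
def regionSequential {d : ℕ} (Q : Fin d → Matrix (Fin d) (Fin d) ℂ) : Set (ℝ × ℝ) :=
  {p ∈ unitSquare | ∃ J : Fin d → (Matrix (Fin d) (Fin d) ℂ →ₗ[ℂ] Matrix (Fin d) (Fin d) ℂ),
    IsInstrument J ∧ ∀ P : Fin d → Matrix (Fin d) (Fin d) ℂ,
      IsSharpMeter P → MutuallyUnbiased Q P →
        IsJointMeter (sequentialMeter J P) (noisy Q p.1) (noisy P p.2)}

/-- `τ_d(s) = 1 - a(s)^2` with `a(s) = (√(s (d - 1) + 1) - √(1 - s)) / √d`. -/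
def tradeOff (d : ℕ) (s : ℝ) : ℝ :=
  1 - ((√(s * (d - 1) + 1) - √(1 - s)) / √(d : ℝ)) ^ 2

end

end QDevices

open QDevices

/-! For unbiased `Q`, `P` every pair `Q x`, `P y` consists of rank-one projections with overlap
`1/d`. Splitting `P y` along `Q x` and its complement, and weighting the cross terms by `k`, bounds
`P y` by an operator in `Q x` alone (`trace_mul_le_of_overlap`). Testing this on `G (x, y)` and
summing, only the two marginals of a joint meter `G` enter; optimizing over `k` gives `t ≤ tradeOff
d s` (`le_tradeOff_of_isJointMeter`).

The bound is attained. The dual of the total Lüders channel of `Q_s` sends each unbiased `P'` to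
`P'` with noise `tradeOff d s`, since `Q x * P' y * Q x = (1/d) Q x` uses only unbiasedness
(`sum_adj_luders`). A further depolarizing channel reaches every smaller `t`, so one instrument
serves all `P'` and the two regions coincide.

Measuring `Q` on one clone turns a cloner into an instrument for `Q_s` and `I_t`, and measuring `P'`
on the output of `I_t` yields `P'_t`; this gives the inclusions. For strictness, `I_t` also fixes
the coherences between the basis vectors of `Q`. The overlap inequality, now applied to matrices of
such coherences, gives another bound (`le_of_mem_regionMeterChannel`), violated at the boundary
point with `t = 1/2`. -/

namespace QDevices

noncomputable section

/-! ### Complete positivity through block matrices -/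

section CompletePositivity

set_option linter.unusedSectionVars false

open scoped ComplexOrder Matrix

variable {m n p : Type*}

/-- Apply a linear map to every block of a block matrix. -/
def blockMap {ι : Type*} (Φ : Matrix m m ℂ →ₗ[ℂ] Matrix n n ℂ)
    (M : Matrix (ι × m) (ι × m) ℂ) : Matrix (ι × n) (ι × n) ℂ :=
  Matrix.of fun p q => Φ (Matrix.of fun a b => M (p.1, a) (q.1, b)) p.2 q.2

theorem exists_eq_star_mul_self {A : Type*} [NonUnitalCStarAlgebra A] [PartialOrder A]
    [StarOrderedRing A] {a : A} (ha : 0 ≤ a) : ∃ b : A, a = star b * b :=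
  CStarAlgebra.nonneg_iff_eq_star_mul_self.mp ha

section Flatten

open scoped MatrixOrder Matrix.Norms.L2Operator

variable {ι : Type*} [Fintype ι] [Fintype n] [DecidableEq n]

/-- A matrix over a matrix algebra, as a block matrix. -/
def flatten (M : CStarMatrix ι ι (Matrix n n ℂ)) : Matrix (ι × n) (ι × n) ℂ :=
  Matrix.of fun p q => M p.1 q.1 p.2 q.2

/-- A block matrix, as a matrix over a matrix algebra. -/
def unflatten (M : Matrix (ι × n) (ι × n) ℂ) : CStarMatrix ι ι (Matrix n n ℂ) :=
  CStarMatrix.ofMatrix (Matrix.of fun i j => Matrix.of fun a b => M (i, a) (j, b))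

theorem flatten_unflatten (M : Matrix (ι × n) (ι × n) ℂ) : flatten (unflatten M) = M := rfl

theorem flatten_star_mul_self (M : CStarMatrix ι ι (Matrix n n ℂ)) :
    flatten (star M * M) = (flatten M)ᴴ * flatten M := by
  ext p q
  simp only [flatten, Matrix.of_apply, CStarMatrix.mul_apply, CStarMatrix.star_apply,
    Matrix.sum_apply, Matrix.mul_apply, Matrix.conjTranspose_apply, Matrix.star_apply,
    Fintype.sum_prod_type]

/-- Positivity on either side means being of the form `star B * B`, and flattening respects products
and adjoints. -/
theorem nonneg_iff_posSemidef_flatten (M : CStarMatrix ι ι (Matrix n n ℂ)) :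
    0 ≤ M ↔ (flatten M).PosSemidef := by
  constructor
  · intro h
    obtain ⟨N, rfl⟩ := exists_eq_star_mul_self h
    rw [flatten_star_mul_self]
    exact Matrix.posSemidef_conjTranspose_mul_self _
  · intro h
    classical
    obtain ⟨B, hB⟩ := exists_eq_star_mul_self h.nonneg
    have : M = star (unflatten B) * unflatten B := by
      have h2 : flatten M = flatten (star (unflatten B) * unflatten B) := by
        rw [flatten_star_mul_self, hB]; rfl
      ext i j a b
      exact congrFun (congrFun h2 (i, a)) (j, b)
    rw [this]
    exact star_mul_self_nonneg _

end Flatten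

variable [Fintype m] [DecidableEq m] [Fintype n] [DecidableEq n] [Fintype p] [DecidableEq p]

open scoped MatrixOrder Matrix.Norms.L2Operator in
theorem isCP_of_blockMap {Φ : Matrix m m ℂ →ₗ[ℂ] Matrix n n ℂ}
    (h : ∀ (k : ℕ) (M : Matrix (Fin k × m) (Fin k × m) ℂ),
      M.PosSemidef → (blockMap Φ M).PosSemidef) : IsCP Φ :=
  ⟨{ Φ with
      map_cstarMatrix_nonneg' := fun k M hM => (nonneg_iff_posSemidef_flatten _).2
        (h k (flatten M) ((nonneg_iff_posSemidef_flatten M).1 hM)) }, rfl⟩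

open scoped MatrixOrder Matrix.Norms.L2Operator in
theorem IsCP.posSemidef_blockMap {Φ : Matrix m m ℂ →ₗ[ℂ] Matrix n n ℂ} (h : IsCP Φ)
    {k : ℕ} {M : Matrix (Fin k × m) (Fin k × m) ℂ} (hM : M.PosSemidef) :
    (blockMap Φ M).PosSemidef := by
  obtain ⟨Ψ, rfl⟩ := h
  exact (nonneg_iff_posSemidef_flatten _).1 (Ψ.map_cstarMatrix_nonneg' k (unflatten M)
    ((nonneg_iff_posSemidef_flatten _).2 (by rwa [flatten_unflatten])))

theorem IsCP.posSemidef_map {Φ : Matrix m m ℂ →ₗ[ℂ] Matrix n n ℂ} (h : IsCP Φ)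
    {A : Matrix m m ℂ} (hA : A.PosSemidef) : (Φ A).PosSemidef :=
  (h.posSemidef_blockMap (k := 1) (hA.submatrix Prod.snd)).submatrix (fun a => (0, a))

theorem IsCP.add {Φ Ψ : Matrix m m ℂ →ₗ[ℂ] Matrix n n ℂ} (hΦ : IsCP Φ) (hΨ : IsCP Ψ) :
    IsCP (Φ + Ψ) :=
  isCP_of_blockMap fun _ _ hM => (hΦ.posSemidef_blockMap hM).add (hΨ.posSemidef_blockMap hM)

theorem IsCP.zero : IsCP (0 : Matrix m m ℂ →ₗ[ℂ] Matrix n n ℂ) :=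
  isCP_of_blockMap fun _ _ _ => Matrix.PosSemidef.zero

theorem IsCP.sum {ι : Type*} (s : Finset ι) {Φ : ι → Matrix m m ℂ →ₗ[ℂ] Matrix n n ℂ}
    (h : ∀ i ∈ s, IsCP (Φ i)) : IsCP (∑ i ∈ s, Φ i) :=
  Finset.sum_induction Φ IsCP (fun _ _ => IsCP.add) IsCP.zero h

theorem IsCP.smul {Φ : Matrix m m ℂ →ₗ[ℂ] Matrix n n ℂ} (h : IsCP Φ) {r : ℝ} (hr : 0 ≤ r) :
    IsCP ((r : ℂ) • Φ) :=
  isCP_of_blockMap fun _ _ hM => (h.posSemidef_blockMap hM).smul (Complex.zero_le_real.2 hr)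

theorem IsCP.comp {Ψ : Matrix n n ℂ →ₗ[ℂ] Matrix p p ℂ} {Φ : Matrix m m ℂ →ₗ[ℂ] Matrix n n ℂ}
    (hΨ : IsCP Ψ) (hΦ : IsCP Φ) : IsCP (Ψ ∘ₗ Φ) :=
  isCP_of_blockMap fun _ _ hM => hΨ.posSemidef_blockMap (hΦ.posSemidef_blockMap hM)

/-- The completely positive map `X ↦ V X Vᴴ`. -/
def conjMap (V : Matrix n m ℂ) : Matrix m m ℂ →ₗ[ℂ] Matrix n n ℂ where
  toFun X := V * X * Vᴴ
  map_add' X Y := by rw [Matrix.mul_add, Matrix.add_mul]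
  map_smul' c X := by simp

@[simp] theorem conjMap_apply (V : Matrix n m ℂ) (X : Matrix m m ℂ) :
    conjMap V X = V * X * Vᴴ := rfl

theorem isCP_conjMap (V : Matrix n m ℂ) : IsCP (conjMap V) := by
  refine isCP_of_blockMap fun k M hM => ?_
  -- `W` is `1 ⊗ V`: conjugating every block by `V` is one conjugation by `W`.
  let W : Matrix (Fin k × n) (Fin k × m) ℂ := Matrix.of fun p q => if p.1 = q.1 then V p.2 q.2 else 0
  convert hM.mul_mul_conjTranspose_same W using 1
  ext p q
  simp only [blockMap, conjMap_apply, W, Matrix.mul_apply, Matrix.of_apply, Fintype.sum_prod_type,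
    Matrix.conjTranspose_apply, ite_mul, zero_mul, mul_ite, mul_zero, apply_ite star, star_zero,
    Finset.sum_mul]
  simp [Finset.sum_ite_irrel]

end CompletePositivity

/-! ### Sharp meters and the overlap inequality -/

section SharpMeters

open scoped ComplexOrder Matrix

variable {d : ℕ} {Q P : Fin d → Matrix (Fin d) (Fin d) ℂ}

theorem trace_mul_nonneg {n : Type*} [Fintype n] {A B : Matrix n n ℂ} (hA : A.PosSemidef)
    (hB : B.PosSemidef) : 0 ≤ (A * B).trace := by
  classical
  open scoped MatrixOrder Matrix.Norms.L2Operator in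
  obtain ⟨C, rfl⟩ := exists_eq_star_mul_self hB.nonneg
  rw [← Matrix.mul_assoc, Matrix.trace_mul_comm, ← Matrix.mul_assoc]
  exact (hA.mul_mul_conjTranspose_same C).trace_nonneg

theorem star_dotProduct_orthonormalBasis (φ : OrthonormalBasis (Fin d) ℂ (EuclideanSpace ℂ (Fin d)))
    (x y : Fin d) : star (φ x).ofLp ⬝ᵥ (φ y).ofLp = if x = y then 1 else 0 := by
  rw [← orthonormal_iff_ite.1 φ.orthonormal x y, EuclideanSpace.inner_eq_star_dotProduct,
    dotProduct_comm]

theorem IsSharpMeter.posSemidef (hQ : IsSharpMeter Q) (x : Fin d) : (Q x).PosSemidef := by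
  obtain ⟨φ, hφ⟩ := hQ
  rw [hφ]
  exact Matrix.posSemidef_vecMulVec_self_star _

theorem IsSharpMeter.mul_eq_ite (hQ : IsSharpMeter Q) (x y : Fin d) :
    Q x * Q y = if x = y then Q x else 0 := by
  obtain ⟨φ, hφ⟩ := hQ
  rw [hφ, hφ, Matrix.vecMulVec_mul_vecMulVec, star_dotProduct_orthonormalBasis]
  split_ifs with h
  · simp [h]
  · simp

theorem IsSharpMeter.mul_self (hQ : IsSharpMeter Q) (x : Fin d) : Q x * Q x = Q x := by
  simp [hQ.mul_eq_ite]

theorem IsSharpMeter.trace (hQ : IsSharpMeter Q) (x : Fin d) : (Q x).trace = 1 := by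
  obtain ⟨φ, hφ⟩ := hQ
  rw [hφ, Matrix.trace_vecMulVec, dotProduct_comm, star_dotProduct_orthonormalBasis, if_pos rfl]

theorem IsSharpMeter.mul_mul_self (hQ : IsSharpMeter Q) (x : Fin d) (A : Matrix (Fin d) (Fin d) ℂ) :
    Q x * A * Q x = (Q x * A).trace • Q x := by
  obtain ⟨φ, hφ⟩ := hQ
  rw [hφ, Matrix.vecMulVec_mul, Matrix.vecMulVec_mul_vecMulVec, Matrix.trace_vecMulVec,
    dotProduct_comm (φ x).ofLp]
  simp [Matrix.vecMulVec_smul]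

theorem IsSharpMeter.sum (hQ : IsSharpMeter Q) : ∑ x, Q x = 1 := by
  obtain ⟨φ, hφ⟩ := hQ
  let U : Matrix (Fin d) (Fin d) ℂ := Matrix.of fun i x => φ x i
  have h1 : Uᴴ * U = 1 := by
    ext x y
    rw [Matrix.one_apply, ← star_dotProduct_orthonormalBasis φ x y]
    simp [U, Matrix.mul_apply, dotProduct]
  -- Orthonormality is `Uᴴ * U = 1`; completeness is the same identity with the factors exchanged.
  rw [← mul_eq_one_comm.1 h1]
  ext i j
  simp [U, hφ, Matrix.mul_apply, Matrix.sum_apply, Matrix.vecMulVec_apply]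

theorem IsSharpMeter.isMeter (hQ : IsSharpMeter Q) : IsMeter Q := ⟨hQ.posSemidef, hQ.sum⟩

theorem MutuallyUnbiased.symm (h : MutuallyUnbiased Q P) : MutuallyUnbiased P Q := fun x y => by
  rw [Matrix.trace_mul_comm, h y x]

/-- Two projections with `P R P = c P` and `R P R = c R` satisfy
`P ≤ (1 + k) c R + (1 + 1/k) (1 - c) (1 - R)`; this is the version tested on a positive
semidefinite operator. -/
theorem trace_mul_le_of_overlap {n : Type*} [Fintype n] {P R G : Matrix n n ℂ}
    {c k : ℝ} (hP : P.IsHermitian) (hR : R.IsHermitian) (hPP : P * P = P) (hRR : R * R = R)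
    (hPRP : P * R * P = (c : ℂ) • P) (hRPR : R * P * R = (c : ℂ) • R) (hc : c < 1) (hk : 0 < k)
    (hG : G.PosSemidef) :
    (G * P).trace.re ≤ (1 + k) * (c * (G * R).trace.re) +
      (1 + 1 / k) * ((1 - c) * (G.trace.re - (G * R).trace.re)) := by
  classical
  have e1 : ∀ Z, P * (P * Z) = P * Z := fun Z => by rw [← Matrix.mul_assoc, hPP]
  have e2 : ∀ Z, R * (R * Z) = R * Z := fun Z => by rw [← Matrix.mul_assoc, hRR]
  have e3 : P * (R * P) = (c : ℂ) • P := by rw [← Matrix.mul_assoc, hPRP]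
  have e4 : R * (P * R) = (c : ℂ) • R := by rw [← Matrix.mul_assoc, hRPR]
  have hcr : ((1 - c : ℝ) : ℂ) = 1 - (c : ℂ) := by push_cast; rfl
  -- `S = (1 - c) 1 - (P - R)²`, which is `1 - c` times a projection. It also equals `(1 - c)(1 - R)
  -- - (1 - R) P (1 - R)`, so its positivity bounds the compression of `P` to the complement of `R`.
  set S : Matrix n n ℂ := ((1 - c : ℝ) : ℂ) • 1 - P - R + P * R + R * P with hS
  have hSH : Sᴴ = S := by
    simp only [hS, Matrix.conjTranspose_add, Matrix.conjTranspose_sub, Matrix.conjTranspose_smul,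
      Matrix.conjTranspose_one, Matrix.conjTranspose_mul, hP.eq, hR.eq, Complex.star_def,
      Complex.conj_ofReal]
    abel
  have hSS : S * Sᴴ = ((1 - c : ℝ) : ℂ) • S := by
    rw [hSH, hS]
    simp only [Matrix.mul_add, Matrix.add_mul, Matrix.mul_sub, Matrix.sub_mul, Matrix.mul_smul,
      Matrix.smul_mul, Matrix.mul_one, Matrix.one_mul, Matrix.mul_assoc, e1, e2, e3, e4,
      hPP, hRR, hcr]
    module
  have h1 : 0 ≤ (1 - c) * (G * S).trace.re := by
    have := (Complex.nonneg_iff.1 (trace_mul_nonneg hG (Matrix.posSemidef_self_mul_conjTranspose S))).1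
    rwa [hSS, Matrix.mul_smul, Matrix.trace_smul, smul_eq_mul, Complex.re_ofReal_mul] at this
  have h1' : 0 ≤ (G * S).trace.re := nonneg_of_mul_nonneg_right h1 (by linarith)
  -- `T = k R - (1 - R)`. After division by `k`, positivity of `T P T` is Young's inequality: the
  -- cross terms of `P` are at most `k R P R + (1/k) (1 - R) P (1 - R)`.
  set T : Matrix n n ℂ := ((k + 1 : ℝ) : ℂ) • R - 1 with hT
  have hTT : (T * P) * (T * P)ᴴ =
      (((k + 1) ^ 2 * c : ℝ) : ℂ) • R - ((k + 1 : ℝ) : ℂ) • (R * P + P * R) + P := by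
    simp only [hT, Matrix.conjTranspose_sub, Matrix.conjTranspose_smul,
      Matrix.conjTranspose_one, Matrix.conjTranspose_mul, hP.eq, hR.eq, Complex.star_def,
      Complex.conj_ofReal]
    simp only [Matrix.mul_sub, Matrix.sub_mul, Matrix.mul_smul,
      Matrix.smul_mul, Matrix.mul_one, Matrix.one_mul, Matrix.mul_assoc, e1, e4, hPP]
    push_cast
    module
  have h2 := (Complex.nonneg_iff.1
    (trace_mul_nonneg hG (Matrix.posSemidef_self_mul_conjTranspose (T * P)))).1
  rw [hTT] at h2
  simp only [hS, Matrix.mul_add, Matrix.mul_sub, Matrix.mul_smul, Matrix.trace_add,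
    Matrix.trace_sub, Matrix.trace_smul, smul_eq_mul, Complex.add_re, Complex.sub_re,
    Complex.re_ofReal_mul, Matrix.mul_one] at h1' h2
  have h3 := div_nonneg h2 hk.le
  have h4 : 0 ≤ (1 + 1 / k) * ((1 - c) * G.trace.re - (G * P).trace.re - (G * R).trace.re +
      (G * (P * R)).trace.re + (G * (R * P)).trace.re) := mul_nonneg (by positivity) h1'
  refine le_of_sub_nonneg ((add_nonneg h3 h4).trans_eq ?_)
  field_simp
  ring

/-- The inequality `q ≤ (1 + k) A + (1 + 1/k) B` for all `k > 0` amounts to `q ≤ (√A + √B)²`. -/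
theorem le_sq_sqrt_add_sqrt {q A B : ℝ} (hA : 0 < A) (hB : 0 ≤ B)
    (h : ∀ k : ℝ, 0 < k → q ≤ (1 + k) * A + (1 + 1 / k) * B) : q ≤ (√A + √B) ^ 2 := by
  rcases hB.eq_or_lt with rfl | hB
  · rw [Real.sqrt_zero, add_zero, Real.sq_sqrt hA.le]
    refine le_of_forall_pos_le_add fun ε hε => ?_
    -- For `B = 0` the infimum is only approached as `k → 0`.
    have := h (ε / A) (by positivity)
    have e : (1 + ε / A) * A = A + ε := by field_simp
    linarith
  · have a := Real.sqrt_pos.2 hA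
    have b := Real.sqrt_pos.2 hB
    -- The minimizer of the right-hand side over `k`.
    have hk := h (√B / √A) (by positivity)
    have eA := Real.sq_sqrt hA.le
    have eB := Real.sq_sqrt hB.le
    generalize √A = x at *
    generalize √B = y at *
    subst eA eB
    refine hk.trans_eq ?_
    field_simp
    ring

end SharpMeters

/-! ### Joint meters: the upper bound and its attainment by the Lüders instrument -/

section JointMeters

set_option linter.unusedSectionVars false

open scoped ComplexOrder Matrix

variable {d : ℕ} {Q P : Fin d → Matrix (Fin d) (Fin d) ℂ}
variable {X Y m n : Type*} [Fintype X] [Fintype Y] [Fintype m] [DecidableEq m] [Fintype n]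
  [DecidableEq n]

/-! ### The Heisenberg picture -/

theorem adj_eq_of_trace {Φ : Matrix m m ℂ →ₗ[ℂ] Matrix n n ℂ} {A : Matrix n n ℂ}
    {B : Matrix m m ℂ} (h : ∀ ρ, (Φ ρ * A).trace = (ρ * B).trace) : adj Φ A = B :=
  Matrix.ext_iff_trace_mul_left.2 fun ρ => by rw [trace_mul_adj, h]

theorem adj_conjMap (V : Matrix n m ℂ) (A : Matrix n n ℂ) : adj (conjMap V) A = Vᴴ * A * V :=
  adj_eq_of_trace fun ρ => by
    rw [conjMap_apply, Matrix.mul_assoc, Matrix.mul_assoc, Matrix.trace_mul_comm]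
    simp only [Matrix.mul_assoc]

theorem adj_add (Φ : Matrix m m ℂ →ₗ[ℂ] Matrix n n ℂ) (A B : Matrix n n ℂ) :
    adj Φ (A + B) = adj Φ A + adj Φ B :=
  adj_eq_of_trace fun ρ => by
    rw [Matrix.mul_add, Matrix.mul_add, Matrix.trace_add, Matrix.trace_add, trace_mul_adj,
      trace_mul_adj]

theorem adj_smul (Φ : Matrix m m ℂ →ₗ[ℂ] Matrix n n ℂ) (c : ℂ) (A : Matrix n n ℂ) :
    adj Φ (c • A) = c • adj Φ A :=
  adj_eq_of_trace fun ρ => by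
    rw [Matrix.mul_smul, Matrix.mul_smul, Matrix.trace_smul, Matrix.trace_smul, trace_mul_adj]

theorem adj_sum (Φ : Matrix m m ℂ →ₗ[ℂ] Matrix n n ℂ) (A : Y → Matrix n n ℂ) :
    adj Φ (∑ y, A y) = ∑ y, adj Φ (A y) :=
  adj_eq_of_trace fun ρ => by
    simp only [Matrix.mul_sum, Matrix.trace_sum, trace_mul_adj]

theorem sum_adj (J : X → Matrix m m ℂ →ₗ[ℂ] Matrix n n ℂ) (A : Matrix n n ℂ) :
    adj (∑ x, J x) A = ∑ x, adj (J x) A :=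
  adj_eq_of_trace fun ρ => by
    simp only [LinearMap.sum_apply, Matrix.mul_sum, Matrix.sum_mul, Matrix.trace_sum, trace_mul_adj]

/-- The positive semidefinite cone is self-dual; rank-one `A` already suffice as tests. -/
theorem posSemidef_of_trace_mul_nonneg {B : Matrix m m ℂ}
    (h : ∀ A : Matrix m m ℂ, A.PosSemidef → 0 ≤ (A * B).trace) : B.PosSemidef := by
  rw [← Matrix.isPositive_toEuclideanLin_iff, LinearMap.isPositive_iff_complex]
  intro x
  have h1 := h _ (Matrix.posSemidef_vecMulVec_self_star x.ofLp)
  have h2 : inner ℂ (Matrix.toEuclideanLin B x) x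
      = star (Matrix.vecMulVec x.ofLp (star x.ofLp) * B).trace := by
    rw [Matrix.vecMulVec_mul, Matrix.trace_vecMulVec, ← inner_conj_symm,
      EuclideanSpace.inner_eq_star_dotProduct, dotProduct_comm x.ofLp, ← Matrix.dotProduct_mulVec,
      dotProduct_comm]
    rfl
  rw [h2]
  obtain ⟨h3, h4⟩ := Complex.nonneg_iff.1 h1
  refine ⟨?_, by simpa using h3⟩
  apply Complex.ext <;> simp [← h4]

theorem IsCP.posSemidef_adj {Φ : Matrix m m ℂ →ₗ[ℂ] Matrix n n ℂ} (h : IsCP Φ)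
    {A : Matrix n n ℂ} (hA : A.PosSemidef) : (adj Φ A).PosSemidef :=
  posSemidef_of_trace_mul_nonneg fun _ hρ => by
    rw [trace_mul_adj]
    exact trace_mul_nonneg (h.posSemidef_map hρ) hA

theorem isInstrument_of_adj {J : X → (Matrix m m ℂ →ₗ[ℂ] Matrix n n ℂ)} (hJ : ∀ x, IsCP (J x))
    (h : ∑ x, adj (J x) 1 = 1) : IsInstrument J where
  isCP := hJ
  isChannel_sum :=
    { isCP := IsCP.sum _ fun x _ => hJ x
      trace_eq := fun A => by
        rw [← Matrix.mul_one ((∑ x, J x) A), ← trace_mul_adj, sum_adj, h, Matrix.mul_one] }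

theorem isJointMeter_sequentialMeter {J : X → (Matrix m m ℂ →ₗ[ℂ] Matrix n n ℂ)}
    {R : Y → Matrix n n ℂ} {M : X → Matrix m m ℂ} {N : Y → Matrix m m ℂ}
    (hJ : ∀ x, IsCP (J x)) (hM : ∀ x, adj (J x) 1 = M x) (hM1 : ∑ x, M x = 1) (hR : IsMeter R)
    (hN : ∀ y, ∑ x, adj (J x) (R y) = N y) : IsJointMeter (sequentialMeter J R) M N := by
  have h1 : ∀ x, ∑ y, sequentialMeter J R (x, y) = M x := fun x => by
    simp only [sequentialMeter]
    rw [← adj_sum, hR.sum_eq_one, hM]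
  refine ⟨⟨fun p => (hJ p.1).posSemidef_adj (hR.posSemidef p.2), ?_⟩, h1, hN⟩
  rw [Fintype.sum_prod_type]
  simp only [h1, hM1]

/-! ### Noisy meters -/

theorem sum_noisy (hd : d ≠ 0) {M : Fin d → Matrix (Fin d) (Fin d) ℂ} (hM : ∑ x, M x = 1) (s : ℝ) :
    ∑ x, noisy M s x = 1 := by
  have : (d : ℂ) ≠ 0 := Nat.cast_ne_zero.2 hd
  simp only [noisy]
  rw [Finset.sum_add_distrib, ← Finset.smul_sum, hM, Finset.sum_const, Finset.card_univ,
    Fintype.card_fin, ← Nat.cast_smul_eq_nsmul ℂ, smul_smul, ← add_smul, mul_div_cancel₀ _ this]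
  simp

theorem isMeter_noisy (hd : d ≠ 0) {M : Fin d → Matrix (Fin d) (Fin d) ℂ} (hM : IsMeter M) {s : ℝ}
    (hs : s ∈ Set.Icc (0 : ℝ) 1) : IsMeter (noisy M s) where
  sum_eq_one := sum_noisy hd hM.sum_eq_one s
  posSemidef := fun x => by
    refine ((hM.posSemidef x).smul (Complex.zero_le_real.2 hs.1)).add
      (Matrix.PosSemidef.one.smul ?_)
    have h : (((1 - s : ℝ) : ℂ) / d) = (((1 - s) / d : ℝ) : ℂ) := by push_cast; rfl
    rw [h, Complex.zero_le_real]
    exact div_nonneg (by linarith [hs.2]) (Nat.cast_nonneg d)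

theorem trace_noisy_mul (s : ℝ) (M : Fin d → Matrix (Fin d) (Fin d) ℂ) (x : Fin d)
    (A : Matrix (Fin d) (Fin d) ℂ) :
    (noisy M s x * A).trace = s * (M x * A).trace + ((1 - s : ℝ) / d : ℂ) * A.trace := by
  rw [noisy, Matrix.add_mul, Matrix.trace_add, Matrix.smul_mul, Matrix.smul_mul,
    Matrix.trace_smul, Matrix.trace_smul, Matrix.one_mul, smul_eq_mul, smul_eq_mul]

theorem IsSharpMeter.trace_noisy_mul_self_re (hQ : IsSharpMeter Q) (s : ℝ) (x : Fin d) :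
    (noisy Q s x * Q x).trace.re = s + (1 - s) / d := by
  rw [trace_noisy_mul, hQ.mul_self, hQ.trace]
  have h : (s : ℂ) * 1 + (((1 - s : ℝ) : ℂ) / d) * 1 = ((s + (1 - s) / d : ℝ) : ℂ) := by
    push_cast; ring
  rw [h, Complex.ofReal_re]

theorem IsSharpMeter.one_sub_posSemidef (hQ : IsSharpMeter Q) (x : Fin d) :
    (1 - Q x).PosSemidef := by
  have h : (1 - Q x) = (1 - Q x) * (1 - Q x)ᴴ := by
    simp only [Matrix.conjTranspose_sub, Matrix.conjTranspose_one,
      (hQ.posSemidef x).isHermitian.eq, Matrix.mul_sub, Matrix.sub_mul, Matrix.mul_one,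
      Matrix.one_mul, hQ.mul_self]
    abel
  rw [h]
  exact Matrix.posSemidef_self_mul_conjTranspose _

theorem IsSharpMeter.mul_mul_of_mutuallyUnbiased (hQ : IsSharpMeter Q) (h : MutuallyUnbiased Q P)
    (x y : Fin d) : Q x * P y * Q x = ((1 / d : ℝ) : ℂ) • Q x := by
  rw [hQ.mul_mul_self, h x y]
  push_cast
  rfl

/-! ### Noise parameters of compatible unbiased meters -/

theorem le_tradeOff_of_isJointMeter (hd : 2 ≤ d) (hQ : IsSharpMeter Q) (hP : IsSharpMeter P)
    (hQP : MutuallyUnbiased Q P) {s t : ℝ} (hs : s ∈ Set.Icc (0 : ℝ) 1)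
    {G : Fin d × Fin d → Matrix (Fin d) (Fin d) ℂ}
    (hG : IsJointMeter G (noisy Q s) (noisy P t)) : t ≤ tradeOff d s := by
  have hd2 : (2 : ℝ) ≤ d := by exact_mod_cast hd
  have hd0 : (0 : ℝ) < d := by linarith
  have hGP : ∑ x, ∑ y, (G (x, y) * P y).trace.re = d * t + 1 - t := by
    rw [Finset.sum_comm]
    have : ∀ y, ∑ x, (G (x, y) * P y).trace.re = t + (1 - t) / d := fun y => by
      rw [← hP.trace_noisy_mul_self_re, ← hG.snd_marginal, Matrix.sum_mul, Matrix.trace_sum,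
        Complex.re_sum]
    simp only [this, Finset.sum_const, Finset.card_univ, Fintype.card_fin, nsmul_eq_mul]
    field_simp
    ring
  have hGQ : ∑ x, ∑ y, (G (x, y) * Q x).trace.re = s * (d - 1) + 1 := by
    have : ∀ x, ∑ y, (G (x, y) * Q x).trace.re = s + (1 - s) / d := fun x => by
      rw [← hQ.trace_noisy_mul_self_re, ← hG.fst_marginal, Matrix.sum_mul, Matrix.trace_sum,
        Complex.re_sum]
    simp only [this, Finset.sum_const, Finset.card_univ, Fintype.card_fin, nsmul_eq_mul]
    field_simp
    ring
  have hG1 : ∑ x, ∑ y, (G (x, y)).trace.re = d := by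
    simp_rw [← Complex.re_sum, ← Matrix.trace_sum]
    rw [← Fintype.sum_prod_type, hG.isMeter.sum_eq_one]
    simp
  have key : ∀ k : ℝ, 0 < k → d * t + 1 - t ≤ (1 + k) * ((s * (d - 1) + 1) / d) +
      (1 + 1 / k) * ((d - 1) ^ 2 * (1 - s) / d) := fun k hk => by
    have h := Finset.sum_le_sum fun x (_ : x ∈ Finset.univ) => Finset.sum_le_sum
      fun y (_ : y ∈ Finset.univ) => trace_mul_le_of_overlap (c := 1 / d)
        (hP.posSemidef y).isHermitian (hQ.posSemidef x).isHermitian (hP.mul_self y) (hQ.mul_self x)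
        (hP.mul_mul_of_mutuallyUnbiased hQP.symm y x) (hQ.mul_mul_of_mutuallyUnbiased hQP x y)
        (by rw [div_lt_one hd0]; linarith) hk (hG.isMeter.posSemidef (x, y))
    simp only [Finset.sum_add_distrib, ← Finset.mul_sum, Finset.sum_sub_distrib] at h
    rw [hGP, hGQ, hG1] at h
    refine h.trans_eq ?_
    field_simp
    ring
  have hu : 0 < s * (d - 1) + 1 := by nlinarith [hs.1]
  have hv : 0 ≤ 1 - s := by linarith [hs.2]
  have := le_sq_sqrt_add_sqrt (by positivity) (by positivity) key
  rw [Real.sqrt_div hu.le, Real.sqrt_div (by positivity), Real.sqrt_mul (by positivity),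
    Real.sqrt_sq (by linarith), ← add_div, div_pow, Real.sq_sqrt hd0.le, le_div_iff₀ hd0] at this
  rw [tradeOff, div_pow, Real.sq_sqrt hd0.le, le_sub_comm, div_le_iff₀ hd0]
  have eu := Real.sq_sqrt hu.le
  have ev := Real.sq_sqrt hv
  have h1 : (0 : ℝ) < d - 1 := by linarith
  refine le_of_mul_le_mul_left ?_ h1
  -- With `u = s (d - 1) + 1` and `v = 1 - s`, the left side is `d (u + (d - 1) v)`, and `u + (d -
  -- 1) v = d`. This turns the optimized bound into the form of `tradeOff`.
  have e : (√(s * (d - 1) + 1) + (d - 1) * √(1 - s)) ^ 2 +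
      (d - 1) * (√(s * (d - 1) + 1) - √(1 - s)) ^ 2 = (d : ℝ) ^ 2 := by
    linear_combination (d : ℝ) * eu + d * (d - 1) * ev
  linarith

/-! ### The Lüders instrument -/

/-- The square root of `Q_s x`. -/
def sqrtNoisy (Q : Fin d → Matrix (Fin d) (Fin d) ℂ) (s : ℝ) (x : Fin d) :
    Matrix (Fin d) (Fin d) ℂ :=
  ((√(s * (d - 1) + 1) / √(d : ℝ) : ℝ) : ℂ) • Q x + ((√(1 - s) / √(d : ℝ) : ℝ) : ℂ) • (1 - Q x)


theorem sqrtNoisy_isHermitian (hQ : IsSharpMeter Q) (s : ℝ) (x : Fin d) :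
    (sqrtNoisy Q s x)ᴴ = sqrtNoisy Q s x := by
  simp only [sqrtNoisy, Matrix.conjTranspose_add, Matrix.conjTranspose_smul,
    Matrix.conjTranspose_sub, Matrix.conjTranspose_one, (hQ.posSemidef x).isHermitian.eq,
    Complex.star_def, Complex.conj_ofReal]

theorem sqrtNoisy_mul_self (hd : 2 ≤ d) (hQ : IsSharpMeter Q) {s : ℝ}
    (hs : s ∈ Set.Icc (0 : ℝ) 1) (x : Fin d) :
    sqrtNoisy Q s x * sqrtNoisy Q s x = noisy Q s x := by
  have hd2 : (2 : ℝ) ≤ d := by exact_mod_cast hd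
  have hd0 : (0 : ℝ) < d := by linarith
  have hu : 0 ≤ s * (d - 1) + 1 := by nlinarith [hs.1]
  have hv : 0 ≤ 1 - s := by linarith [hs.2]
  have ea : (√(s * (d - 1) + 1) / √(d : ℝ)) ^ 2 = s + (1 - s) / d := by
    rw [div_pow, Real.sq_sqrt hu, Real.sq_sqrt hd0.le]
    field_simp
    ring
  have eb : (√(1 - s) / √(d : ℝ)) ^ 2 = (1 - s) / d := by
    rw [div_pow, Real.sq_sqrt hv, Real.sq_sqrt hd0.le]
  have hb : (((1 - s : ℝ) : ℂ) / d) = (((1 - s) / d : ℝ) : ℂ) := by push_cast; rfl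
  have es := eq_sub_of_add_eq ea.symm
  rw [← eb] at es
  rw [noisy, sqrtNoisy, hb, ← eb]
  generalize √(s * (d - 1) + 1) / √(d : ℝ) = a at es ⊢
  generalize √(1 - s) / √(d : ℝ) = b at es ⊢
  rw [es]
  simp only [Matrix.mul_add, Matrix.add_mul, Matrix.mul_sub, Matrix.sub_mul, Matrix.mul_smul,
    Matrix.smul_mul, Matrix.mul_one, Matrix.one_mul, hQ.mul_self]
  push_cast
  module

theorem sqrtNoisy_posSemidef (hQ : IsSharpMeter Q) (s : ℝ) (x : Fin d) :
    (sqrtNoisy Q s x).PosSemidef := by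
  exact ((hQ.posSemidef x).smul (Complex.zero_le_real.2 (by positivity))).add
    ((hQ.one_sub_posSemidef x).smul (Complex.zero_le_real.2 (by positivity)))

open scoped MatrixOrder in
theorem sqrt_noisy (hd : 2 ≤ d) (hQ : IsSharpMeter Q) {s : ℝ}
    (hs : s ∈ Set.Icc (0 : ℝ) 1) (x : Fin d) : CFC.sqrt (noisy Q s x) = sqrtNoisy Q s x :=
  CFC.sqrt_unique (sqrtNoisy_mul_self hd hQ hs x) (sqrtNoisy_posSemidef hQ s x).nonneg

theorem luders_noisy (hd : 2 ≤ d) (hQ : IsSharpMeter Q) {s : ℝ}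
    (hs : s ∈ Set.Icc (0 : ℝ) 1) (x : Fin d) :
    luders (noisy Q s) x = conjMap (sqrtNoisy Q s x) := by
  refine LinearMap.ext fun ρ => ?_
  simp only [luders, LinearMap.comp_apply, LinearMap.mulRight_apply, LinearMap.mulLeft_apply,
    sqrt_noisy hd hQ hs, conjMap_apply, sqrtNoisy_isHermitian hQ, Matrix.mul_assoc]

theorem isCP_luders (hd : 2 ≤ d) (hQ : IsSharpMeter Q) {s : ℝ}
    (hs : s ∈ Set.Icc (0 : ℝ) 1) (x : Fin d) : IsCP (luders (noisy Q s) x) := by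
  rw [luders_noisy hd hQ hs]
  exact isCP_conjMap _

theorem adj_luders (hd : 2 ≤ d) (hQ : IsSharpMeter Q) {s : ℝ}
    (hs : s ∈ Set.Icc (0 : ℝ) 1) (x : Fin d) (A : Matrix (Fin d) (Fin d) ℂ) :
    adj (luders (noisy Q s) x) A = sqrtNoisy Q s x * A * sqrtNoisy Q s x := by
  rw [luders_noisy hd hQ hs, adj_conjMap, sqrtNoisy_isHermitian hQ]

theorem adj_luders_one (hd : 2 ≤ d) (hQ : IsSharpMeter Q) {s : ℝ}
    (hs : s ∈ Set.Icc (0 : ℝ) 1) (x : Fin d) :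
    adj (luders (noisy Q s) x) 1 = noisy Q s x := by
  rw [adj_luders hd hQ hs, Matrix.mul_one, sqrtNoisy_mul_self hd hQ hs]

theorem isInstrument_luders (hd : 2 ≤ d) (hQ : IsSharpMeter Q) {s : ℝ}
    (hs : s ∈ Set.Icc (0 : ℝ) 1) : IsInstrument (luders (noisy Q s)) := by
  refine isInstrument_of_adj (isCP_luders hd hQ hs) ?_
  simp only [adj_luders_one hd hQ hs]
  exact sum_noisy (by omega) hQ.sum s

/-- With `a`, `b` the eigenvalues of `√(Q_s x)`, so that the root is `b 1 + (a - b) Q x`, the sum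
over `x` leaves `d b² + 2 b (a - b)` times `P y`, plus `(a - b)² / d` times `1` from the terms `Q x
* P y * Q x`. The first coefficient is `1 - (a - b)²`. -/
theorem sum_adj_luders (hd : 2 ≤ d) (hQ : IsSharpMeter Q) (hQP : MutuallyUnbiased Q P) {s : ℝ}
    (hs : s ∈ Set.Icc (0 : ℝ) 1) (y : Fin d) :
    ∑ x, adj (luders (noisy Q s) x) (P y) = noisy P (tradeOff d s) y := by
  have hd2 : (2 : ℝ) ≤ d := by exact_mod_cast hd
  have hd0 : (0 : ℝ) < d := by linarith
  have hu : 0 ≤ s * (d - 1) + 1 := by nlinarith [hs.1]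
  have hv : 0 ≤ 1 - s := by linarith [hs.2]
  -- This is `tr (Q_s x) = 1`.
  have eab : (√(s * (d - 1) + 1) / √(d : ℝ)) ^ 2 + (d - 1) * (√(1 - s) / √(d : ℝ)) ^ 2 = 1 := by
    rw [div_pow, div_pow, Real.sq_sqrt hu, Real.sq_sqrt hd0.le, Real.sq_sqrt hv]
    field_simp
    ring
  simp only [adj_luders hd hQ hs, sqrtNoisy, noisy, tradeOff, sub_div]
  generalize √(s * (d - 1) + 1) / √(d : ℝ) = a at *
  generalize √(1 - s) / √(d : ℝ) = b at *
  have h : ∀ x, ((a : ℂ) • Q x + (b : ℂ) • (1 - Q x)) * P y * ((a : ℂ) • Q x + (b : ℂ) • (1 - Q x))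
      = ((b ^ 2 : ℝ) : ℂ) • P y + ((b * (a - b) : ℝ) : ℂ) • (Q x * P y + P y * Q x)
        + (((a - b) ^ 2 / d : ℝ) : ℂ) • Q x := fun x => by
    have e : (((a - b) ^ 2 / d : ℝ) : ℂ) • Q x = (((a - b) ^ 2 : ℝ) : ℂ) • (Q x * P y * Q x) := by
      rw [hQ.mul_mul_of_mutuallyUnbiased hQP, smul_smul]
      congr 1
      push_cast
      ring
    rw [e]
    simp only [Matrix.mul_add, Matrix.add_mul, Matrix.mul_sub, Matrix.sub_mul, Matrix.mul_smul,
      Matrix.smul_mul, Matrix.mul_one, Matrix.one_mul]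
    push_cast
    module
  simp only [h, Finset.sum_add_distrib, ← Finset.smul_sum, ← Matrix.sum_mul, ← Matrix.mul_sum,
    hQ.sum, Matrix.mul_one, Matrix.one_mul, Finset.sum_const, Finset.card_univ, Fintype.card_fin,
    ← Nat.cast_smul_eq_nsmul ℂ]
  have e1 : ((1 - (a - b) ^ 2 : ℝ) : ℂ) = (d : ℂ) * ((b ^ 2 : ℝ) : ℂ) + 2 * ((b * (a - b) : ℝ) : ℂ) := by
    have : (1 - (a - b) ^ 2 : ℝ) = d * b ^ 2 + 2 * (b * (a - b)) := by linear_combination -eab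
    rw [this]
    push_cast
    ring
  have e2 : (((1 - (1 - (a - b) ^ 2) : ℝ) : ℂ) / d) = (((a - b) ^ 2 / d : ℝ) : ℂ) := by
    push_cast
    ring
  rw [e1, e2]
  module

theorem tradeOff_mem_Icc (hd : 2 ≤ d) {s : ℝ} (hs : s ∈ Set.Icc (0 : ℝ) 1) :
    tradeOff d s ∈ Set.Icc (0 : ℝ) 1 := by
  have hd2 : (2 : ℝ) ≤ d := by exact_mod_cast hd
  have hd0 : (0 : ℝ) < d := by linarith
  have hu : 0 ≤ s * (d - 1) + 1 := by nlinarith [hs.1]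
  have hv : 0 ≤ 1 - s := by linarith [hs.2]
  have hvu : √(1 - s) ≤ √(s * (d - 1) + 1) := Real.sqrt_le_sqrt (by nlinarith [hs.1])
  refine ⟨sub_nonneg.2 ?_, sub_le_self _ (sq_nonneg _)⟩
  rw [div_pow, Real.sq_sqrt hd0.le, div_le_one hd0]
  have h0 := Real.sqrt_nonneg (1 - s)
  have h1 : (√(s * (d - 1) + 1) - √(1 - s)) ^ 2 ≤ √(s * (d - 1) + 1) ^ 2 :=
    pow_le_pow_left₀ (by linarith) (by linarith) 2
  rw [Real.sq_sqrt hu] at h1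
  nlinarith [hs.2]

theorem isJointMeter_luders (hd : 2 ≤ d) (hQ : IsSharpMeter Q) (hP : IsSharpMeter P)
    (hQP : MutuallyUnbiased Q P) {s : ℝ} (hs : s ∈ Set.Icc (0 : ℝ) 1) :
    IsJointMeter (sequentialMeter (luders (noisy Q s)) P) (noisy Q s) (noisy P (tradeOff d s)) :=
  isJointMeter_sequentialMeter (isCP_luders hd hQ hs) (adj_luders_one hd hQ hs)
    (sum_noisy (by omega) hQ.sum s) hP.isMeter (sum_adj_luders hd hQ hQP hs)

theorem exists_mul_eq_of_le {t a : ℝ} (ht : 0 ≤ t) (h : t ≤ a) :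
    ∃ r ∈ Set.Icc (0 : ℝ) 1, r * a = t := by
  rcases (ht.trans h).eq_or_lt with h0 | h0
  · exact ⟨0, by simp, by linarith⟩
  · exact ⟨t / a, ⟨by positivity, (div_le_one h0).2 h⟩, div_mul_cancel₀ _ h0.ne'⟩

theorem noisy_noisy (hd : d ≠ 0) (M : Fin d → Matrix (Fin d) (Fin d) ℂ) (r t : ℝ) (y : Fin d) :
    (r : ℂ) • noisy M t y + ((1 - r : ℝ) / d : ℂ) • (1 : Matrix (Fin d) (Fin d) ℂ)
      = noisy M (r * t) y := by
  have : (d : ℂ) ≠ 0 := Nat.cast_ne_zero.2 hd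
  simp only [noisy, smul_add, smul_smul, add_assoc, ← add_smul]
  push_cast
  congr 2
  field_simp
  ring

theorem isJointMeter_luders_noisy (hd : 2 ≤ d) (hQ : IsSharpMeter Q) (hP : IsSharpMeter P)
    (hQP : MutuallyUnbiased Q P) {s r : ℝ} (hs : s ∈ Set.Icc (0 : ℝ) 1)
    (hr : r ∈ Set.Icc (0 : ℝ) 1) :
    IsJointMeter (sequentialMeter (luders (noisy Q s)) (noisy P r)) (noisy Q s)
      (noisy P (r * tradeOff d s)) := by
  refine isJointMeter_sequentialMeter (isCP_luders hd hQ hs) (adj_luders_one hd hQ hs)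
    (sum_noisy (by omega) hQ.sum s) (isMeter_noisy (by omega) hP.isMeter hr) fun y => ?_
  rw [← noisy_noisy (by omega) P r, ← sum_adj_luders hd hQ hQP hs]
  simp only [noisy, adj_add, adj_smul, Finset.sum_add_distrib, ← Finset.smul_sum]
  simp only [adj_luders_one hd hQ hs, sum_noisy (by omega) hQ.sum s]

end JointMeters

/-! ### Comparison of the regions -/

section Regions

set_option linter.unusedSectionVars false

open scoped ComplexOrder Matrix

variable {d : ℕ} {Q P : Fin d → Matrix (Fin d) (Fin d) ℂ}

/-! ### Depolarizing channels -/

theorem adj_comp {m n p : Type*} [Fintype m] [DecidableEq m] [Fintype n] [DecidableEq n]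
    [Fintype p] [DecidableEq p] (Ψ : Matrix n n ℂ →ₗ[ℂ] Matrix p p ℂ)
    (Φ : Matrix m m ℂ →ₗ[ℂ] Matrix n n ℂ) (A : Matrix p p ℂ) :
    adj (Ψ ∘ₗ Φ) A = adj Φ (adj Ψ A) :=
  adj_eq_of_trace fun ρ => by rw [LinearMap.comp_apply, trace_mul_adj, trace_mul_adj]

/-- The completely depolarizing map `ρ ↦ tr(ρ) 1`, by its Kraus operators. -/
def traceMap (d : ℕ) : Matrix (Fin d) (Fin d) ℂ →ₗ[ℂ] Matrix (Fin d) (Fin d) ℂ :=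
  ∑ i, ∑ j, conjMap (Matrix.single i j 1)

theorem traceMap_apply (ρ : Matrix (Fin d) (Fin d) ℂ) : traceMap d ρ = ρ.trace • 1 := by
  ext a b
  simp [traceMap, LinearMap.sum_apply, Matrix.sum_apply, Matrix.trace, Matrix.single_mul_mul_single,
    Matrix.single_apply, Matrix.one_apply, Finset.sum_ite_irrel, ite_and]

theorem isCP_traceMap : IsCP (traceMap d) :=
  IsCP.sum _ fun _ _ => IsCP.sum _ fun _ _ => isCP_conjMap _

/-- The depolarizing channel as a linear map. -/
def depolMap (d : ℕ) (r : ℝ) : Matrix (Fin d) (Fin d) ℂ →ₗ[ℂ] Matrix (Fin d) (Fin d) ℂ :=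
  (r : ℂ) • conjMap 1 + (((1 - r) / d : ℝ) : ℂ) • traceMap d

theorem isCP_depolMap {r : ℝ} (hr : r ∈ Set.Icc (0 : ℝ) 1) : IsCP (depolMap d r) :=
  ((isCP_conjMap 1).smul hr.1).add
    (isCP_traceMap.smul (div_nonneg (by linarith [hr.2]) (Nat.cast_nonneg d)))

theorem depolMap_apply (r : ℝ) (ρ : Matrix (Fin d) (Fin d) ℂ) :
    depolMap d r ρ = depol d r ρ := by
  simp [depolMap, depol, traceMap_apply, smul_smul]

theorem trace_depol_mul (r : ℝ) (ρ A : Matrix (Fin d) (Fin d) ℂ) :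
    (depol d r ρ * A).trace = r * (ρ * A).trace + ((1 - r : ℝ) / d : ℂ) * ρ.trace * A.trace := by
  rw [depol, Matrix.add_mul, Matrix.trace_add, Matrix.smul_mul, Matrix.smul_mul,
    Matrix.trace_smul, Matrix.trace_smul, Matrix.one_mul, smul_eq_mul, smul_eq_mul]

theorem IsSharpMeter.trace_depol_mul (hP : IsSharpMeter P) (r : ℝ) (ρ : Matrix (Fin d) (Fin d) ℂ)
    (y : Fin d) : (depol d r ρ * P y).trace = (ρ * noisy P r y).trace := by
  rw [QDevices.trace_depol_mul, hP.trace, Matrix.trace_mul_comm ρ (noisy P r y), trace_noisy_mul,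
    Matrix.trace_mul_comm ρ, mul_one]

theorem adj_depolMap (hP : IsSharpMeter P) (r : ℝ) (y : Fin d) :
    adj (depolMap d r) (P y) = noisy P r y :=
  adj_eq_of_trace fun ρ => by rw [depolMap_apply, hP.trace_depol_mul]

theorem adj_depolMap_one (hd : d ≠ 0) (r : ℝ) : adj (depolMap d r) 1 = 1 :=
  adj_eq_of_trace fun ρ => by
    have : (d : ℂ) ≠ 0 := Nat.cast_ne_zero.2 hd
    rw [depolMap_apply, trace_depol_mul, Matrix.mul_one, Matrix.trace_one, Fintype.card_fin]
    push_cast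
    field_simp
    ring

/-! ### Inclusions -/

/-- The noise needed to lower `tradeOff d s` to `t` is put into the instrument as a depolarizing
channel, which does not depend on `P`. -/
theorem mem_regionSequential_of_le (hd : 2 ≤ d) (hQ : IsSharpMeter Q) {p : ℝ × ℝ}
    (hp : p ∈ unitSquare) (h : p.2 ≤ tradeOff d p.1) : p ∈ regionSequential Q := by
  obtain ⟨r, hr, hrt⟩ := exists_mul_eq_of_le hp.2.1 h
  refine ⟨hp, fun x => depolMap d r ∘ₗ luders (noisy Q p.1) x, ?_, fun P hP hQP => ?_⟩
  · refine isInstrument_of_adj (fun x => (isCP_depolMap hr).comp (isCP_luders hd hQ hp.1 x)) ?_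
    simp only [adj_comp, adj_depolMap_one (d := d) (by omega), adj_luders_one hd hQ hp.1]
    exact sum_noisy (by omega) hQ.sum _
  · have := isJointMeter_luders_noisy hd hQ hP hQP hp.1 hr
    rw [hrt] at this
    convert this using 1
    funext q
    simp only [sequentialMeter, adj_comp, adj_depolMap hP]

theorem regionMeters_eq (hd : 2 ≤ d) (hQ : IsSharpMeter Q) (hP : IsSharpMeter P)
    (hQP : MutuallyUnbiased Q P) :
    regionMeters Q P = {p ∈ unitSquare | p.2 ≤ tradeOff d p.1} := by
  ext p
  refine ⟨fun ⟨hp, G, hG⟩ => ⟨hp, le_tradeOff_of_isJointMeter hd hQ hP hQP hp.1 hG⟩,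
    fun ⟨hp, h⟩ => ?_⟩
  obtain ⟨-, J, -, hJ⟩ := mem_regionSequential_of_le hd hQ hp h
  exact ⟨hp, _, hJ P hP hQP⟩

theorem regionSequential_eq (hd : 2 ≤ d) (hQ : IsSharpMeter Q) (hP : IsSharpMeter P)
    (hQP : MutuallyUnbiased Q P) : regionSequential Q = regionMeters Q P := by
  refine Set.Subset.antisymm (fun p ⟨hp, J, _, hJ⟩ => ⟨hp, _, hJ P hP hQP⟩) fun p h => ?_
  rw [regionMeters_eq hd hQ hP hQP] at h
  exact mem_regionSequential_of_le hd hQ h.1 h.2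

theorem regionMeterChannel_subset (hd : d ≠ 0) (hQ : IsSharpMeter Q) :
    regionMeterChannel Q ⊆ regionSequential Q := by
  rintro p ⟨hp, J, hJ, h1, h2⟩
  refine ⟨hp, J, hJ, fun P hP _ => isJointMeter_sequentialMeter hJ.isCP h1
    (sum_noisy hd hQ.sum _) hP.isMeter fun y => ?_⟩
  rw [← sum_adj]
  exact adj_eq_of_trace fun ρ => by rw [LinearMap.sum_apply, h2, hP.trace_depol_mul]

theorem regionCloning_subset (hd : d ≠ 0) (hQ : IsSharpMeter Q) :
    regionCloning d ⊆ regionMeterChannel Q := by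
  rintro p ⟨hp, Γ, hΓ, h1, h2⟩
  have hsum := hQ.sum
  have hQ' := hQ
  obtain ⟨φ, hφ⟩ := hQ'
  -- `V x` is `⟨φ x| ⊗ 1`: outcome `x` of `Q` on the first clone, with the second clone kept.
  let V (x : Fin d) : Matrix (Fin d) (Fin d × Fin d) ℂ :=
    Matrix.of fun a q => if a = q.2 then star (φ x q.1) else 0
  have hV : ∀ x (A : Matrix (Fin d × Fin d) (Fin d × Fin d) ℂ) a b,
      conjMap (V x) A a b = ∑ i, ∑ j, Q x j i * A (i, a) (j, b) := fun x A a b => by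
    simp only [conjMap_apply, V, Matrix.mul_apply, Matrix.of_apply, Fintype.sum_prod_type,
      Matrix.conjTranspose_apply, ite_mul, zero_mul, mul_ite, mul_zero, apply_ite star, star_zero,
      Finset.sum_mul, hφ, Matrix.vecMulVec_apply, Pi.star_apply]
    simp only [Finset.sum_ite_eq, Finset.mem_univ, if_true, star_star]
    rw [Finset.sum_comm]
    exact Finset.sum_congr rfl fun i _ => Finset.sum_congr rfl fun j _ => by ring
  have hadj : ∀ x, adj (conjMap (V x) ∘ₗ Γ) 1 = noisy Q p.1 x := fun x =>
    adj_eq_of_trace fun ρ => by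
      rw [← hQ.trace_depol_mul, ← h1, Matrix.mul_one]
      simp only [Matrix.trace, Matrix.diag_apply, LinearMap.comp_apply, hV, Matrix.mul_apply,
        ptrSnd, Matrix.of_apply, Finset.sum_mul]
      rw [Finset.sum_comm]
      refine Finset.sum_congr rfl fun i _ => ?_
      rw [Finset.sum_comm]
      exact Finset.sum_congr rfl fun j _ => Finset.sum_congr rfl fun a _ => mul_comm _ _
  refine ⟨hp, fun x => conjMap (V x) ∘ₗ Γ, ?_, hadj, fun ρ => ?_⟩
  · refine isInstrument_of_adj (fun x => (isCP_conjMap _).comp hΓ.isCP) ?_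
    simp only [hadj]
    exact sum_noisy hd hsum _
  · rw [← h2]
    ext a b
    simp only [Matrix.sum_apply, LinearMap.comp_apply, hV, ptrFst, Matrix.of_apply]
    rw [Finset.sum_comm]
    refine Finset.sum_congr rfl fun i _ => ?_
    rw [Finset.sum_comm]
    simp only [← Finset.sum_mul, ← Matrix.sum_apply, hsum, Matrix.one_apply, ite_mul, one_mul,
      zero_mul, Finset.sum_ite_eq', Finset.mem_univ, if_true]

/-! ### Strictness -/

/-- Block `(i, j)` of the image of the positive rank-one block matrix `(v i (v j)ᴴ)` is `Φ (v i (v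
j)ᴴ)`. Compressing block row `i` by `v i` leaves the stated scalars. -/
theorem IsCP.posSemidef_compression {n : Type*} [Fintype n] [DecidableEq n]
    {Φ : Matrix n n ℂ →ₗ[ℂ] Matrix n n ℂ} (h : IsCP Φ) {k : ℕ} (v : Fin k → n → ℂ) :
    (Matrix.of fun i j =>
      star (v i) ⬝ᵥ Φ (Matrix.vecMulVec (v i) (star (v j))) *ᵥ v j).PosSemidef := by
  have h1 := h.posSemidef_blockMap
    (Matrix.posSemidef_vecMulVec_self_star fun q : Fin k × n => v q.1 q.2)
  let W : Matrix (Fin k) (Fin k × n) ℂ := Matrix.of fun i q => if i = q.1 then star (v i q.2) else 0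
  convert h1.mul_mul_conjTranspose_same W using 1
  ext i j
  simp only [Matrix.of_apply, W, blockMap, Matrix.mul_apply, Fintype.sum_prod_type,
    Matrix.conjTranspose_apply, ite_mul, zero_mul, mul_ite, mul_zero, apply_ite star, star_zero,
    Finset.sum_mul, star_star, dotProduct, Matrix.mulVec, Finset.mul_sum, Pi.star_apply]
  have e : ∀ i j, (Matrix.of fun a b => Matrix.vecMulVec (fun q : Fin k × n => v q.1 q.2)
      (star fun q : Fin k × n => v q.1 q.2) (i, a) (j, b)) = Matrix.vecMulVec (v i) (star (v j)) :=
    fun i j => rfl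
  simp only [e, Finset.sum_ite_irrel, Finset.sum_const_zero, Finset.sum_ite_eq, Finset.mem_univ,
    if_true]
  rw [Finset.sum_comm]
  exact Finset.sum_congr rfl fun a _ => Finset.sum_congr rfl fun b _ => by ring

/-- The diagonal entries of a positive semidefinite matrix, compared with its overlap with the
uniform unit vector. -/
theorem diag_le_of_posSemidef (hd : 2 ≤ d) {G : Matrix (Fin d) (Fin d) ℂ} (hG : G.PosSemidef)
    {k : ℝ} (hk : 0 < k) (x : Fin d) :
    (G x x).re ≤ (1 + k) * (1 / d * (1 / d * (∑ i, ∑ j, (G i j).re))) +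
      (1 + 1 / k) * ((1 - 1 / d) * (∑ i, (G i i).re - 1 / d * (∑ i, ∑ j, (G i j).re))) := by
  have hd2 : (2 : ℝ) ≤ d := by exact_mod_cast hd
  have hd0 : (d : ℂ) ≠ 0 := Nat.cast_ne_zero.2 (by omega)
  let R : Matrix (Fin d) (Fin d) ℂ := Matrix.of fun _ _ => ((1 / d : ℝ) : ℂ)
  have h := trace_mul_le_of_overlap (P := Matrix.single x x 1) (R := R) (c := 1 / d)
    (by rw [Matrix.IsHermitian, Matrix.conjTranspose_single, star_one])
    (by ext i j; simp [R])
    (by simp)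
    (by ext i j; simp [R, Matrix.mul_apply]; field_simp)
    (by
      rw [Matrix.single_mul_mul_single]
      simp [R, Matrix.smul_single])
    (by
      ext i j
      simp [R, Matrix.mul_apply, Matrix.single_apply, ite_and])
    (by rw [div_lt_one (by linarith)]; linarith) hk hG
  have e1 : (G * Matrix.single x x 1).trace = G x x := by
    simp [Matrix.trace_mul_single]
  have e2 : (G * R).trace.re = 1 / d * (∑ i, ∑ j, (G i j).re) := by
    simp only [Matrix.trace, Matrix.diag_apply, Matrix.mul_apply, R, Matrix.of_apply,
      ← Finset.sum_mul]
    rw [Complex.re_mul_ofReal, mul_comm, Complex.re_sum]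
    simp only [Complex.re_sum]
  have e3 : G.trace.re = ∑ i, (G i i).re := by
    simp only [Matrix.trace, Matrix.diag_apply, Complex.re_sum]
  rwa [e1, e2, e3] at h

/-- On input `Q x`, the probability of outcome `x` splits according to whether the output passes the
test `Q x`. The passing part is a diagonal entry of the positive matrix `D x`, controlled by the
entry sums and traces of the `D x`, whose totals over `x` are fixed by `I_t`. The failing part is at
most the total leakage of `I_t` out of `Q x`. -/
theorem le_of_mem_regionMeterChannel (hd : 2 ≤ d) (hQ : IsSharpMeter Q) {p : ℝ × ℝ}
    (h : p ∈ regionMeterChannel Q) {k : ℝ} (hk : 0 < k) :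
    p.1 * (d - 1) + 1 ≤ (1 + k) * ((d * p.2 + (1 - p.2) / d) / d) +
      (1 + 1 / k) * ((1 - 1 / d) ^ 2 * (1 - p.2)) + (d - 1) * (1 - p.2) := by
  have hd2 : (2 : ℝ) ≤ d := by exact_mod_cast hd
  have hd0 : (0 : ℝ) < d := by linarith
  obtain ⟨s, t⟩ := p
  obtain ⟨hp, J, hJ, h1, h2⟩ := h
  simp only at h1 h2 ⊢
  have hQ' := hQ
  obtain ⟨φ, hφ⟩ := hQ'
  let D (x : Fin d) : Matrix (Fin d) (Fin d) ℂ := Matrix.of fun i j =>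
    star (φ i).ofLp ⬝ᵥ J x (Matrix.vecMulVec (φ i).ofLp (star (φ j).ofLp)) *ᵥ (φ j).ofLp
  have hD : ∀ x, (D x).PosSemidef := fun x => (hJ.isCP x).posSemidef_compression _
  have hDx : ∀ x, D x x x = (J x (Q x) * Q x).trace := fun x => by
    simp only [D, Matrix.of_apply, ← hφ]
    rw [hφ x, Matrix.mul_vecMulVec, Matrix.trace_vecMulVec, dotProduct_comm]
  have hsum : ∀ i j, ∑ x, (D x i j).re = t + if i = j then (1 - t) / d else 0 := fun i j => by
    have : ∑ x, D x i j = ((t + if i = j then (1 - t) / d else 0 : ℝ) : ℂ) := by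
      simp only [D, Matrix.of_apply]
      rw [← dotProduct_sum, ← Matrix.sum_mulVec, h2, depol, Matrix.add_mulVec, dotProduct_add,
        Matrix.smul_mulVec, Matrix.smul_mulVec, Matrix.one_mulVec, dotProduct_smul, dotProduct_smul,
        Matrix.vecMulVec_mulVec, star_dotProduct_orthonormalBasis, Matrix.trace_vecMulVec,
        dotProduct_comm (φ i).ofLp, star_dotProduct_orthonormalBasis]
      rcases eq_or_ne i j with rfl | hij
      · simp [star_dotProduct_orthonormalBasis]
      · simp [star_dotProduct_orthonormalBasis, hij, hij.symm]
    rw [← Complex.re_sum, this, Complex.ofReal_re]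
  have hdiag : ∑ x, (D x x x).re ≤ (1 + k) * ((d * t + (1 - t) / d) / d) +
      (1 + 1 / k) * ((1 - 1 / d) ^ 2 * (1 - t)) := by
    have h3 := Finset.sum_le_sum fun x (_ : x ∈ Finset.univ) =>
      diag_le_of_posSemidef hd (hD x) hk x
    simp only [Finset.sum_add_distrib, ← Finset.mul_sum, Finset.sum_sub_distrib] at h3
    have e1 : ∑ x, ∑ i, ∑ j, (D x i j).re = d ^ 2 * t + (1 - t) := by
      rw [Finset.sum_comm]
      have : ∀ i, ∑ x, ∑ j, (D x i j).re = d * t + (1 - t) / d := fun i => by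
        rw [Finset.sum_comm]
        simp [hsum, Finset.sum_add_distrib]
      simp only [this, Finset.sum_const, Finset.card_univ, Fintype.card_fin, nsmul_eq_mul]
      field_simp
    have e2 : ∑ x, ∑ i, (D x i i).re = d * t + (1 - t) := by
      rw [Finset.sum_comm]
      simp only [hsum, if_true, Finset.sum_const, Finset.card_univ, Fintype.card_fin, nsmul_eq_mul]
      field_simp
    rw [e1, e2] at h3
    refine h3.trans_eq ?_
    field_simp
    ring
  have hoff : ∀ x, (J x (Q x) * (1 - Q x)).trace.re ≤ (1 - t) / d * (d - 1) := fun x => by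
    have hnn : ∀ x', 0 ≤ (J x' (Q x) * (1 - Q x)).trace.re := fun x' =>
      (Complex.nonneg_iff.1 (trace_mul_nonneg ((hJ.isCP x').posSemidef_map (hQ.posSemidef x))
        (hQ.one_sub_posSemidef x))).1
    refine (Finset.single_le_sum (fun x' _ => hnn x') (Finset.mem_univ x)).trans_eq ?_
    rw [← Complex.re_sum, ← Matrix.trace_sum, ← Matrix.sum_mul, h2, trace_depol_mul, Matrix.mul_sub,
      Matrix.mul_one, hQ.mul_self, sub_self, Matrix.trace_zero, hQ.trace, Matrix.trace_sub,
      hQ.trace, Matrix.trace_one, Fintype.card_fin]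
    have : (t : ℂ) * 0 + ((1 - t : ℝ) / d : ℂ) * 1 * (d - 1) = (((1 - t) / d * (d - 1) : ℝ) : ℂ) := by
      push_cast; ring
    rw [this, Complex.ofReal_re]
  have htot : ∀ x, (D x x x).re + (J x (Q x) * (1 - Q x)).trace.re = s + (1 - s) / d := fun x => by
    rw [← hQ.trace_noisy_mul_self_re s x, ← h1, Matrix.trace_mul_comm (adj _ _), trace_mul_adj, hDx,
      ← Complex.add_re, ← Matrix.trace_add, ← Matrix.mul_add]
    simp
  have h5 := Finset.sum_congr rfl fun x (_ : x ∈ Finset.univ) => htot x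
  have h6 := Finset.sum_le_sum fun x (_ : x ∈ Finset.univ) => hoff x
  simp only [Finset.sum_add_distrib, Finset.sum_const, Finset.card_univ, Fintype.card_fin,
    nsmul_eq_mul] at h5 h6
  have e5 : (d : ℝ) * (s + (1 - s) / d) = s * (d - 1) + 1 := by field_simp; ring
  have e6 : (d : ℝ) * ((1 - t) / d * (d - 1)) = (d - 1) * (1 - t) := by field_simp
  linarith

theorem exists_mem_regionSequential_notMem (hd : 2 ≤ d) (hQ : IsSharpMeter Q) :
    ∃ p ∈ regionSequential Q, p ∉ regionMeterChannel Q := by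
  have hd2 : (2 : ℝ) ≤ d := by exact_mod_cast hd
  have hd0 : (0 : ℝ) < d := by linarith
  obtain ⟨w, hw0, hw⟩ : ∃ w : ℝ, 0 ≤ w ∧ w ^ 2 = d + 1 :=
    ⟨_, Real.sqrt_nonneg _, Real.sq_sqrt (by linarith)⟩
  obtain ⟨z, hz0, hz⟩ : ∃ z : ℝ, 0 < z ∧ z ^ 2 = (d : ℝ) ^ 2 + 1 :=
    ⟨_, Real.sqrt_pos.2 (by positivity), Real.sq_sqrt (by positivity)⟩
  have hw1 : 1 ≤ w := by nlinarith
  -- The solution of `tradeOff d s = 1/2`: here `√(1 - s) = (w - 1) / √(2d)` and `√(s (d - 1) + 1) =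
  -- (w + d - 1) / √(2d)`, which differ by `√(d/2)`.
  set s : ℝ := 1 - (w - 1) ^ 2 / (2 * d) with hs
  have hu : s * (d - 1) + 1 = (w + d - 1) ^ 2 / (2 * d) := by
    rw [hs]
    field_simp
    linear_combination (-(d : ℝ)) * hw
  have hv : 1 - s = (w - 1) ^ 2 / (2 * d) := by rw [hs]; ring
  have hs01 : s ∈ Set.Icc (0 : ℝ) 1 := by
    refine ⟨sub_nonneg.2 ?_, sub_le_self _ (by positivity)⟩
    rw [div_le_one (by positivity)]
    nlinarith
  have hτ : tradeOff d s = 1 / 2 := by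
    rw [tradeOff, hu, hv, Real.sqrt_div (sq_nonneg _), Real.sqrt_div (sq_nonneg _),
      Real.sqrt_sq (by linarith), Real.sqrt_sq (by linarith), ← sub_div, div_pow, div_pow,
      Real.sq_sqrt hd0.le, Real.sq_sqrt (by positivity)]
    field_simp
    ring
  refine ⟨(s, 1 / 2), mem_regionSequential_of_le hd hQ ⟨hs01, by norm_num⟩ hτ.ge, fun h => ?_⟩
  -- At `t = 1/2` the bound has `A = z² / (2d²)` and `B = (d - 1)² / (2d²)`, so this `k` is the
  -- optimal `√B / √A`.
  have h1 := le_of_mem_regionMeterChannel hd hQ h (k := (d - 1) / z) (by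
    have : (0 : ℝ) < d - 1 := by linarith
    positivity)
  simp only [hu] at h1
  have hd1 : (0 : ℝ) < d - 1 := by linarith
  have e : (1 + (d - 1) / z) * ((d * (1 / 2) + (1 - 1 / 2) / d) / d) +
      (1 + 1 / ((d - 1) / z)) * ((1 - 1 / d) ^ 2 * (1 - 1 / 2)) + (d - 1) * (1 - 1 / 2)
      = ((z + d - 1) ^ 2 + d ^ 2 * (d - 1)) / (2 * (d : ℝ) ^ 2) := by
    have e1 : (d * (1 / 2) + (1 - 1 / 2) / d) / d = z ^ 2 / (2 * (d : ℝ) ^ 2) := by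
      rw [hz]; field_simp; ring
    rw [e1]
    field_simp
    ring
  rw [e, div_le_div_iff₀ (by positivity) (by positivity)] at h1
  have hzd : z < d + 1 := by nlinarith
  have hlt : z + (d - 1) < d * w := by
    refine lt_of_pow_lt_pow_left₀ 2 (by positivity) ?_
    have : (d * w) ^ 2 = (d : ℝ) ^ 2 * (d + 1) := by rw [mul_pow, hw]
    rw [this]
    -- By `z < d + 1`, the left square is below `4d² - 2d`, and `d² (d + 1) - (4d² - 2d) = d (d -
    -- 1)(d - 2) ≥ 0`.
    nlinarith [mul_pos hd1 (sub_pos.2 hzd), mul_nonneg hd1.le (sub_nonneg.2 hd2)]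
  have h2 : d * (w + d - 1) ^ 2 ≤ (z + d - 1) ^ 2 + (d : ℝ) ^ 2 * (d - 1) := by
    refine le_of_mul_le_mul_left ?_ (show (0 : ℝ) < 2 * d by positivity)
    linarith
  have h3 : d * (w + d - 1) ^ 2 - ((z + d - 1) ^ 2 + (d : ℝ) ^ 2 * (d - 1))
      = 2 * (d - 1) * (d * w - (z + (d - 1))) := by
    linear_combination (d : ℝ) * hw - hz
  have h4 := mul_pos (mul_pos two_pos hd1) (sub_pos.2 hlt)
  linarith

end Regions

end

end QDevices

open QDevices

theorem mainTheorem4 (d : ℕ) (hd : 2 ≤ d) (Q P : Fin d → Matrix (Fin d) (Fin d) ℂ)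
    (hQ : IsSharpMeter Q) (hP : IsSharpMeter P) (hQP : MutuallyUnbiased Q P) :
    -- the two strategies have the same region of achievable noise parameters
    regionSequential Q = regionMeters Q P ∧
    -- the region is the part of the unit square below the graph of `tradeOff d`
    regionMeters Q P = {p ∈ unitSquare | p.2 ≤ tradeOff d p.1} ∧
    -- the Lüders instrument of `Q_s`, followed by an unbiased `P'` chosen later, attains the
    -- optimal boundary point, simultaneously for all such `P'`
    (∀ s ∈ Set.Icc (0 : ℝ) 1,
      tradeOff d s ∈ Set.Icc (0 : ℝ) 1 ∧
      IsInstrument (luders (noisy Q s)) ∧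
      (∀ x, adj (luders (noisy Q s) x) 1 = noisy Q s x) ∧
      ∀ P' : Fin d → Matrix (Fin d) (Fin d) ℂ, IsSharpMeter P' → MutuallyUnbiased Q P' →
        IsJointMeter (sequentialMeter (luders (noisy Q s)) P')
          (noisy Q s) (noisy P' (tradeOff d s))) ∧
    -- every point of the region is attained by the Lüders instrument of `Q_s` followed by a
    -- suitably noisy measurement of an unbiased `P'` chosen later
    (∀ p ∈ regionMeters Q P, ∃ r ∈ Set.Icc (0 : ℝ) 1,
      ∀ P' : Fin d → Matrix (Fin d) (Fin d) ℂ, IsSharpMeter P' → MutuallyUnbiased Q P' →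
        IsJointMeter (sequentialMeter (luders (noisy Q p.1)) (noisy P' r))
          (noisy Q p.1) (noisy P' p.2)) ∧
    -- the scheme is strictly better than cloning, and than the sequential scheme for arbitrary `P`
    regionCloning d ⊂ regionSequential Q ∧
    regionMeterChannel Q ⊂ regionSequential Q := by
  have hd0 : d ≠ 0 := by omega
  obtain ⟨q, hq, hq'⟩ := exists_mem_regionSequential_notMem hd hQ
  have hMC := regionMeterChannel_subset hd0 hQ
  have hC := regionCloning_subset hd0 hQ
  refine ⟨regionSequential_eq hd hQ hP hQP, regionMeters_eq hd hQ hP hQP,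
    fun s hs => ⟨tradeOff_mem_Icc hd hs, isInstrument_luders hd hQ hs, adj_luders_one hd hQ hs,
      fun P' hP' hQP' => isJointMeter_luders hd hQ hP' hQP' hs⟩, fun p hp => ?_,
    (Set.ssubset_iff_of_subset (hC.trans hMC)).2 ⟨q, hq, fun h => hq' (hC h)⟩,
    (Set.ssubset_iff_of_subset hMC).2 ⟨q, hq, hq'⟩⟩
  rw [regionMeters_eq hd hQ hP hQP] at hp
  obtain ⟨r, hr, hrt⟩ := exists_mul_eq_of_le hp.1.2.1 hp.2
  exact ⟨r, hr, fun P' hP' hQP' => hrt ▸ isJointMeter_luders_noisy hd hQ hP' hQP' hp.1.1 hr⟩
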